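/- Let $H=(V_H,E_H)$ be a fixed finite simple graph with at least two edges, let $P=(E_H,\prec)$ be any strict partial order on its edges, and let $$\rho_H=\min_{I}\frac{|V_I|}{|E_I|-1},$$ where the minimum is over all subgraphs $I=(V_I,E_I)$ of $H$ with $|E_I|\ge 2$. Let $\psi$ be a fixed probability distribution on $\mathbb{N}_0$ whose first and second moments are positive and finite. A random temporal graph $\mathcal{G}=([n],E,\lambda)$ drawn from $\Gamma_{[n]}(\psi)$ is obtained as follows: independently for each pair $e\in\binom{[n]}{2}$ one draws a number $l_e\sim\psi$, and $\lambda(e)$ is the set of $l_e$ independent samples, uniform on $(0,1]$ and independent of $l_e$; the edges are the pairs with at least one label. For $\delta\in\mathbb{R}$, a temporal graph $\mathcal{G}=(V,E,\lambda)$ contains $(H,P)$ as a $\delta$-temporal motif if there are a subgraph $(V',E')$ of $(V,E)$, a choice of one label $\lambda'(e)\in\lambda(e)$ for each $e\in E'$, and an isomorphism $\Phi$ from $H$ onto $(V',E')$ such that $\lambda'(\Phi(u)\Phi(v))<\lambda'(\Phi(w)\Phi(x))$ whenever $uv\prec wx$, and $\max_{e_1,e_2\in E'}\bigl(\lambda'(e_1)-\lambda'(e_2)\bigr)<\delta$.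 Then for every $\delta:\mathbb{N}\to\mathbb{R}$: 1. if $\delta(n)=\omega(n^{-\rho_H})$, i.e. $\delta(n)/n^{-\rho_H}\to+\infty$, then the probability that a sample from $\Gamma_{[n]}(\psi)$ contains $(H,P)$ as a $\delta(n)$-temporal motif tends to $1$ as $n\to\infty$; 2. if $\delta(n)=o(n^{-\rho_H})$, then the probability that a sample from $\Gamma_{[n]}(\psi)$ does not contain $(H,P)$ as a $\delta(n)$-temporal motif tends to $1$ as $n\to\infty$. -/

import Mathlib

open MeasureTheory Filter Topology Asymptotics

noncomputable section

/-- The sparsity of a finite graph `H`: the minimum of `|V_I| / (|E_I| - 1)` over the subgraphs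
`I` of `H` for which this ratio is meaningful, i.e. those with at least two edges. -/
def sparsity {W : Type*} (H : SimpleGraph W) : ℝ :=
  sInf {x : ℝ | ∃ I : H.Subgraph, 2 ≤ I.edgeSet.ncard ∧
    x = (I.verts.ncard : ℝ) / ((I.edgeSet.ncard : ℝ) - 1)}

/-- If `H` has at least two edges, the infimum in the definition of `sparsity` is a minimum. -/
theorem sparsity_isLeast {W : Type*} [Finite W] (H : SimpleGraph W)
    (hH : 2 ≤ H.edgeSet.ncard) :
    IsLeast {x : ℝ | ∃ I : H.Subgraph, 2 ≤ I.edgeSet.ncard ∧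
      x = (I.verts.ncard : ℝ) / ((I.edgeSet.ncard : ℝ) - 1)} (sparsity H) := by
  classical
  have hfin : Set.Finite {x : ℝ | ∃ I : H.Subgraph, 2 ≤ I.edgeSet.ncard ∧
      x = (I.verts.ncard : ℝ) / ((I.edgeSet.ncard : ℝ) - 1)} := by
    refine (Set.finite_range
      (fun I : H.Subgraph => (I.verts.ncard : ℝ) / ((I.edgeSet.ncard : ℝ) - 1))).subset ?_
    rintro x ⟨I, -, rfl⟩
    exact ⟨I, rfl⟩
  refine ⟨Set.Nonempty.csInf_mem ⟨_, ⊤, ?_, rfl⟩ hfin, fun x hx => csInf_le hfin.bddBelow hx⟩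
  simpa using hH

/-- A temporal graph on the vertex set `V`: a footprint graph together with a set of time labels
for each edge. Only the labels of edges of the footprint are meaningful. -/
structure TemporalGraph (V : Type*) where
  /-- The underlying static graph. -/
  footprint : SimpleGraph V
  /-- The set of occurrences of each edge. -/
  labels : Sym2 V → Set ℝ

/-- `G` contains `(H, P)` as a `δ`-temporal motif: there are a simple temporal subgraph
`(V', E', l)` of `G`, where `I = (V', E')` and `l` chooses one label of each edge of `E'`, and an
isomorphism `φ` of `H` onto `I` such that `l` respects the strict order `P` on the edges of `H`
and all the labels chosen lie within a duration less than `δ`. -/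
def TemporalGraph.ContainsMotif {V W : Type*} (G : TemporalGraph V) (H : SimpleGraph W)
    (P : H.edgeSet → H.edgeSet → Prop) (δ : ℝ) : Prop :=
  ∃ (I : G.footprint.Subgraph) (l : Sym2 V → ℝ) (φ : H ≃g I.coe),
    (∀ e ∈ I.edgeSet, l e ∈ G.labels e) ∧
    (∀ e f : H.edgeSet, P e f →
      l (Sym2.map (fun w => (φ w : V)) (e : Sym2 W)) <
        l (Sym2.map (fun w => (φ w : V)) (f : Sym2 W))) ∧
    (∀ e ∈ I.edgeSet, ∀ f ∈ I.edgeSet, l e - l f < δ)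

/-- `ψ` is a label multiplicity distribution: its first and second moments are positive and
finite. -/
structure IsLabelMultiplicity (ψ : PMF ℕ) : Prop where
  first_pos : 0 < ∑' k : ℕ, ψ k * (k : ENNReal)
  first_lt_top : ∑' k : ℕ, ψ k * (k : ENNReal) < ⊤
  second_pos : 0 < ∑' k : ℕ, ψ k * (k : ENNReal) ^ 2
  second_lt_top : ∑' k : ℕ, ψ k * (k : ENNReal) ^ 2 < ⊤

/-- The uniform distribution on `(0, 1]`. -/
def unifIoc : Measure ℝ := volume.restrict (Set.Ioc 0 1)

instance unifIoc_isProbabilityMeasure : IsProbabilityMeasure unifIoc :=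
  ⟨by simp [unifIoc]⟩

/-- The pairs of distinct vertices. -/
abbrev PotentialEdge (V : Type*) : Type _ := {e : Sym2 V // ¬ e.IsDiag}

/-- The sample space of the random temporal graph on `V`: each potential edge gets a number of
labels and an infinite sequence of candidate labels, of which only the first so many are used. -/
abbrev LabelSpace (V : Type*) : Type _ := PotentialEdge V → ℕ × (ℕ → ℝ)

/-- The randomness behind `Γ_V(ψ)`: independently for each potential edge, the number of labels
has law `ψ` and, independently of it, the candidate labels are i.i.d. uniform on `(0, 1]`. -/
def labelMeasure (V : Type*) [Fintype V] [DecidableEq V] (ψ : PMF ℕ) : Measure (LabelSpace V) :=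
  Measure.pi fun _ => ψ.toMeasure.prod (Measure.infinitePi fun _ : ℕ => unifIoc)

/-- The set of labels of `e` at the sample point `ω`: the first `l_e` candidate labels. -/
def sampledLabels {V : Type*} (ω : LabelSpace V) (e : Sym2 V) : Set ℝ :=
  {t | ∃ h : ¬ e.IsDiag, ∃ i < (ω ⟨e, h⟩).1, (ω ⟨e, h⟩).2 i = t}

/-- The random temporal graph `Γ_V(ψ)`, as a function on the sample space that carries
`labelMeasure V ψ`. The edges are the pairs that received at least one label. -/
def sampledGraph {V : Type*} (ω : LabelSpace V) : TemporalGraph V where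
  footprint := SimpleGraph.fromEdgeSet {e | (sampledLabels ω e).Nonempty}
  labels := sampledLabels ω

end

/-! A subgraph `I` with `v` vertices and `e` edges has about `n ^ v` possible positions, and `e`
labels fall within duration `δ` of each other with probability of order `δ ^ (e - 1)`, one label
being free. The expected number of close copies is thus of order `n ^ v * δ ^ (e - 1)`, and `n ^
(-ρ)` is the value of `δ` below which this vanishes for some `I`.

Below the threshold, a first moment bound for an `I` attaining the sparsity suffices
(`labelMeasure_hasCloseCopy_le`); the order `P` is ignored.

Above it, time is cut into `K` windows of length at most `δ`, each cut into one slot per edge of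
`H`. A copy counts only if the first label of every edge lies in the slot given by its height in
`P`, all in one window. Copies without a common edge have nonpositive covariance, and copies with a
common edge in different windows exclude each other. The other pairs are grouped by their overlap, a
subgraph of `H`, so the sparsity controls them (`pow_ncard_edgeSet_le`). The variance is then
negligible against the squared mean. -/

/-! ### General probabilistic tools -/

/-- **Second moment method.** The probability that none of the events `A a` occurs is bounded by
the sum of their covariances divided by the squared sum of their probabilities. -/
theorem sq_sum_mul_measureReal_iInter_compl_le {Ω α : Type*} [MeasurableSpace Ω] [Fintype α]
    (μ : Measure Ω) [IsProbabilityMeasure μ] (A : α → Set Ω) (hA : ∀ a, MeasurableSet (A a)) :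
    (∑ a, μ.real (A a)) ^ 2 * μ.real (⋂ a, (A a)ᶜ) ≤
      ∑ a, ∑ b, (μ.real (A a ∩ A b) - μ.real (A a) * μ.real (A b)) := by
  set E : ℝ := ∑ a, μ.real (A a) with hE
  set X : Ω → ℝ := fun ω => ∑ a, (A a).indicator 1 ω with hX
  have hint : ∀ s : Set Ω, MeasurableSet s → Integrable (s.indicator (1 : Ω → ℝ)) μ := fun s hs =>
    (integrable_const (1 : ℝ)).indicator hs
  have hXint : Integrable X μ := integrable_finsetSum _ fun a _ => hint _ (hA a)
  have hEX : ∫ ω, X ω ∂μ = E := by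
    simp only [hX]
    rw [integral_finsetSum _ fun a _ => hint _ (hA a)]
    exact Finset.sum_congr rfl fun a _ => integral_indicator_one (hA a)
  have hX2 : ∀ ω, X ω ^ 2 = ∑ a, ∑ b, (A a ∩ A b).indicator (1 : Ω → ℝ) ω := by
    intro ω
    simp only [hX, sq, Finset.sum_mul_sum, Set.inter_indicator_one, Pi.mul_apply]
  have hX2int : Integrable (fun ω => X ω ^ 2) μ := by
    simp only [hX2]
    exact integrable_finsetSum _ fun a _ => integrable_finsetSum _ fun b _ =>
      hint _ ((hA a).inter (hA b))
  have hEX2 : ∫ ω, X ω ^ 2 ∂μ = ∑ a, ∑ b, μ.real (A a ∩ A b) := by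
    simp only [hX2]
    rw [integral_finsetSum _ fun a _ => integrable_finsetSum _ fun b _ =>
      hint _ ((hA a).inter (hA b))]
    refine Finset.sum_congr rfl fun a _ => ?_
    rw [integral_finsetSum _ fun b _ => hint _ ((hA a).inter (hA b))]
    exact Finset.sum_congr rfl fun b _ => integral_indicator_one ((hA a).inter (hA b))
  have hB : MeasurableSet (⋂ a, (A a)ᶜ) := MeasurableSet.iInter fun a => (hA a).compl
  have hvar : ∫ ω, (X ω - E) ^ 2 ∂μ =
      ∑ a, ∑ b, (μ.real (A a ∩ A b) - μ.real (A a) * μ.real (A b)) := by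
    have h1 : ∀ ω, (X ω - E) ^ 2 = X ω ^ 2 - 2 * E * X ω + E ^ 2 := fun ω => by ring
    simp only [h1]
    rw [integral_add (f := fun ω => X ω ^ 2 - 2 * E * X ω) (hX2int.sub (hXint.const_mul _))
      (integrable_const _), integral_sub hX2int (hXint.const_mul _), integral_const_mul, hEX, hEX2]
    simp only [Finset.sum_sub_distrib, integral_const, probReal_univ, smul_eq_mul]
    rw [← Finset.sum_mul_sum, ← hE]
    ring
  -- Chebyshev's inequality pointwise: where no `A a` occurs, `X = 0` and `(X - E) ^ 2 = E ^ 2`;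
  -- elsewhere the left side is zero.
  rw [← hvar, ← integral_indicator_one hB, ← integral_const_mul]
  refine integral_mono ((hint _ hB).const_mul _) ?_ fun ω => ?_
  · have h1 : (fun ω => (X ω - E) ^ 2) = fun ω => X ω ^ 2 - 2 * E * X ω + E ^ 2 := by
      ext ω; ring
    rw [h1]
    exact (hX2int.sub (hXint.const_mul _)).add (integrable_const _)
  · by_cases hω : ω ∈ ⋂ a, (A a)ᶜ
    · have h0 : X ω = 0 := Finset.sum_eq_zero fun a _ =>
        Set.indicator_of_notMem (Set.mem_iInter.1 hω a) _
      simp [hω, h0]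
    · simp only [Set.indicator_of_notMem hω, mul_zero]
      positivity

/-- Under a power of a probability measure, constraints on distinct coordinates are independent. -/
theorem measure_pi_setOf_forall_mem {ι κ Ω : Type*} [Fintype ι] [Fintype κ] [MeasurableSpace Ω]
    (ν : Measure Ω) [IsProbabilityMeasure ν] (g : κ → ι) (hg : Function.Injective g)
    (S : κ → Set Ω) :
    Measure.pi (fun _ : ι => ν) {ω | ∀ a, ω (g a) ∈ S a} = ∏ a, ν (S a) := by
  classical
  -- A box: by injectivity each coordinate carries at most one constraint, and coordinates outside
  -- the range of `g` carry none.
  have h : {ω : ι → Ω | ∀ a, ω (g a) ∈ S a} =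
      Set.pi Set.univ fun x => ⋂ a, ⋂ _ : g a = x, S a := by
    ext ω
    simp only [Set.mem_ofPred_eq, Set.mem_pi, Set.mem_univ, Set.mem_iInter, true_imp_iff]
    exact ⟨fun h x a hax => hax ▸ h a, fun h a => h _ a rfl⟩
  rw [h, Measure.pi_pi, ← Finset.prod_subset (Finset.subset_univ (Finset.univ.image g)),
    Finset.prod_image fun a _ b _ hab => hg hab]
  · refine Finset.prod_congr rfl fun a _ => ?_
    congr 1
    ext y
    simp only [Set.mem_iInter]
    exact ⟨fun h => h a rfl, fun h b hb => hg hb ▸ h⟩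
  · intro x _ hx
    have : (⋂ a, ⋂ _ : g a = x, S a) = Set.univ := by
      refine Set.eq_univ_of_forall fun y => ?_
      simp only [Set.mem_iInter]
      rintro a rfl
      exact absurd (Finset.mem_image_of_mem g (Finset.mem_univ a)) hx
    rw [this, measure_univ]

/-- If the complements of the sets `A n` are eventually small in probability, then the sets `A n`
have probability tending to one, whether or not they are measurable. -/
theorem tendsto_measure_one_of_compl {Ω : ℕ → Type*} [∀ n, MeasurableSpace (Ω n)]
    (μ : ∀ n, Measure (Ω n)) [∀ n, IsProbabilityMeasure (μ n)] (A : ∀ n, Set (Ω n)) (u : ℕ → ℝ)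
    (hu : Tendsto u atTop (𝓝 0)) (h : ∀ᶠ n in atTop, μ n (A n)ᶜ ≤ ENNReal.ofReal (u n)) :
    Tendsto (fun n => μ n (A n)) atTop (𝓝 1) := by
  have h1 : Tendsto (fun n => 1 - ENNReal.ofReal (u n)) atTop (𝓝 1) := by
    have := ENNReal.Tendsto.sub (tendsto_const_nhds (x := (1 : ENNReal)) (f := atTop (α := ℕ)))
      (ENNReal.tendsto_ofReal hu) (Or.inl ENNReal.one_ne_top)
    simpa using this
  refine tendsto_of_tendsto_of_tendsto_of_le_of_le' h1 tendsto_const_nhds ?_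
    (Eventually.of_forall fun n => prob_le_one)
  filter_upwards [h] with n hn
  -- Only subadditivity is used, so measurability plays no role.
  rw [tsub_le_iff_right, ← measure_univ (μ := μ n), ← Set.union_compl_self (A n)]
  exact (measure_union_le _ _).trans (by gcongr)

/-! ### The law of a single edge -/

/-- The image of an edge under an injective map of the vertices. -/
def edgeImage {V W : Type*} {H : SimpleGraph W} (φ : W ↪ V) (e : H.edgeSet) : PotentialEdge V :=
  ⟨Sym2.map φ e, fun h => H.not_isDiag_of_mem_edgeSet e.2
    ((Sym2.isDiag_map φ.injective).1 h)⟩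

theorem edgeImage_injective {V W : Type*} {H : SimpleGraph W} (φ : W ↪ V) :
    Function.Injective (edgeImage (H := H) φ) := fun _ _ h =>
  Subtype.ext (Sym2.map.injective φ.injective (congrArg Subtype.val h))

/-- The law of the multiplicity and the candidate labels of a single potential edge. -/
noncomputable abbrev edgeLaw (ψ : PMF ℕ) : Measure (ℕ × (ℕ → ℝ)) :=
  ψ.toMeasure.prod (Measure.infinitePi fun _ : ℕ => unifIoc)

instance labelMeasure_isProbabilityMeasure (V : Type*) [Fintype V] [DecidableEq V] (ψ : PMF ℕ) :
    IsProbabilityMeasure (labelMeasure V ψ) := by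
  unfold labelMeasure; infer_instance

/-- A constraint on the `i`-th candidate label of an edge with more than `i` labels. -/
theorem edgeLaw_setOf_lt_and_mem (ψ : PMF ℕ) (i : ℕ) {B : Set ℝ} (hB : MeasurableSet B) :
    edgeLaw ψ {z | i < z.1 ∧ z.2 i ∈ B} = ψ.toMeasure {l | i < l} * unifIoc B := by
  have h : {z : ℕ × (ℕ → ℝ) | i < z.1 ∧ z.2 i ∈ B} =
      {l | i < l} ×ˢ ((fun x : ℕ → ℝ => x i) ⁻¹' B) := rfl
  rw [h, edgeLaw, Measure.prod_prod,
    (measurePreserving_eval_infinitePi (fun _ : ℕ => unifIoc) i).measure_preimage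
      hB.nullMeasurableSet]

/-- Tail-sum formula for the mean, by exchanging the two sums. -/
theorem tsum_toMeasure_lt (ψ : PMF ℕ) :
    ∑' i : ℕ, ψ.toMeasure {l | i < l} = ∑' k : ℕ, ψ k * (k : ENNReal) := by
  have h : ∀ i : ℕ, ψ.toMeasure {l | i < l} = ∑' k, if i < k then ψ k else 0 := fun i => by
    rw [PMF.toMeasure_apply _ (MeasurableSet.of_discrete)]
    exact tsum_congr fun k => by simp [Set.indicator_apply]
  simp_rw [h]
  rw [ENNReal.tsum_comm]
  refine tsum_congr fun k => ?_
  rw [tsum_eq_sum (s := Finset.range k) (fun i hi => if_neg (by simpa using hi)),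
    Finset.sum_congr rfl (fun i hi => if_pos (Finset.mem_range.1 hi))]
  simp [mul_comm]

/-- Markov's inequality for the number of labels of an edge in a given set. -/
theorem edgeLaw_exists_mem_le (ψ : PMF ℕ) {B : Set ℝ} (hB : MeasurableSet B) :
    edgeLaw ψ {z | ∃ i < z.1, z.2 i ∈ B} ≤ (∑' k : ℕ, ψ k * (k : ENNReal)) * unifIoc B := by
  have h : {z : ℕ × (ℕ → ℝ) | ∃ i < z.1, z.2 i ∈ B} = ⋃ i, {z | i < z.1 ∧ z.2 i ∈ B} := by
    ext z; simp
  rw [h, ← tsum_toMeasure_lt, ← ENNReal.tsum_mul_right]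
  exact (measure_iUnion_le _).trans (ENNReal.tsum_le_tsum fun i =>
    (edgeLaw_setOf_lt_and_mem ψ i hB).le)

theorem toMeasure_pos_of_first_pos (ψ : PMF ℕ) (h : 0 < ∑' k : ℕ, ψ k * (k : ENNReal)) :
    0 < ψ.toMeasure {l | 0 < l} := by
  rw [← tsum_toMeasure_lt, pos_iff_ne_zero, Ne, ENNReal.tsum_eq_zero, not_forall] at h
  obtain ⟨i, hi⟩ := h
  refine (pos_iff_ne_zero.2 hi).trans_le (measure_mono fun l hl => ?_)
  exact (Nat.zero_le i).trans_lt hl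

/-! ### First moment: no motif below the threshold -/

/-- The reals whose cell in the grid of mesh `1 / K` on `[0, 1]` is the `k`-th or the next one;
reals outside of `[0, 1]` are assigned to the extreme cells. -/
def gridWindow (K k : ℕ) : Set ℝ :=
  {x | k ≤ min ⌊(K : ℝ) * x⌋₊ K ∧ min ⌊(K : ℝ) * x⌋₊ K ≤ k + 1}

theorem measurableSet_gridWindow (K k : ℕ) : MeasurableSet (gridWindow K k) := by
  have h : Measurable fun x : ℝ => min ⌊(K : ℝ) * x⌋₊ K :=
    (Nat.measurable_floor.comp (measurable_const_mul _)).min measurable_const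
  exact h (MeasurableSet.of_discrete (s := Set.Icc k (k + 1)))

theorem unifIoc_gridWindow_le {K : ℕ} (hK : 0 < K) (k : ℕ) :
    unifIoc (gridWindow K k) ≤ ENNReal.ofReal (2 / K) := by
  have hK' : (0 : ℝ) < K := Nat.cast_pos.2 hK
  rw [unifIoc, Measure.restrict_apply (measurableSet_gridWindow K k)]
  have hsub : gridWindow K k ∩ Set.Ioc 0 1 ⊆ Set.Icc ((k : ℝ) / K) ((k + 2 : ℝ) / K) := by
    rintro x ⟨⟨h1, h2⟩, hx0, hx1⟩
    have h0 : 0 ≤ (K : ℝ) * x := by positivity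
    have hle : ⌊(K : ℝ) * x⌋₊ ≤ K := by
      have : ⌊(K : ℝ) * x⌋₊ ≤ ⌊(K : ℝ)⌋₊ := Nat.floor_mono (by nlinarith)
      simpa using this
    rw [min_eq_left hle] at h1 h2
    constructor
    · rw [div_le_iff₀ hK', mul_comm]
      exact (Nat.cast_le.2 h1).trans (Nat.floor_le h0)
    · rw [le_div_iff₀ hK', mul_comm]
      have h3 := Nat.lt_floor_add_one ((K : ℝ) * x)
      have h4 : (⌊(K : ℝ) * x⌋₊ : ℝ) ≤ k + 1 := by exact_mod_cast h2
      linarith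
  refine (measure_mono hsub).trans ?_
  rw [Real.volume_Icc]
  refine ENNReal.ofReal_le_ofReal (le_of_eq ?_)
  field_simp
  ring

/-- Finitely many reals whose pairwise differences are below the mesh of the grid lie in a common
window. -/
theorem exists_forall_mem_gridWindow {α : Type*} [Finite α] [Nonempty α] {K : ℕ} (hK : 0 < K)
    (l : α → ℝ) (hl : ∀ a b, l a - l b < 1 / K) :
    ∃ k ≤ K, ∀ a, l a ∈ gridWindow K k := by
  have hK' : (0 : ℝ) < K := Nat.cast_pos.2 hK
  obtain ⟨b, hb⟩ := Finite.exists_min fun a => min ⌊(K : ℝ) * l a⌋₊ K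
  refine ⟨_, min_le_right _ _, fun a => ⟨hb a, ?_⟩⟩
  have h1 : (K : ℝ) * l a ≤ K * l b + 1 := by
    have := (lt_div_iff₀ hK').1 (hl a b)
    linarith
  have h2 : ⌊(K : ℝ) * l a⌋₊ ≤ ⌊(K : ℝ) * l b⌋₊ + 1 := by
    -- `Nat.floor` sends negative reals to `0`, so a negative minimum is treated apart.
    rcases le_total 0 ((K : ℝ) * l b) with h0 | h0
    · rw [← Nat.floor_add_one h0]
      exact Nat.floor_mono h1
    · have : ⌊(K : ℝ) * l a⌋₊ ≤ ⌊(1 : ℝ)⌋₊ := Nat.floor_mono (by linarith)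
      simp only [Nat.floor_one] at this
      omega
  omega

/-- There is a copy of `H` in the complete graph on `V` with a choice of labels whose pairwise
differences are less than `δ`. -/
def HasCloseCopy {V W : Type*} (ω : LabelSpace V) (H : SimpleGraph W) (δ : ℝ) : Prop :=
  ∃ (φ : W ↪ V) (l : H.edgeSet → ℝ),
    (∀ e, l e ∈ sampledLabels ω (edgeImage φ e : Sym2 V)) ∧ ∀ e f, l e - l f < δ

/-- The motif is restricted to `J` and the order constraints are dropped; for an upper bound
closeness of the labels is enough. -/
theorem hasCloseCopy_of_containsMotif {V W : Type*} {ω : LabelSpace V} {H : SimpleGraph W}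
    {P : H.edgeSet → H.edgeSet → Prop} {δ : ℝ} (h : (sampledGraph ω).ContainsMotif H P δ)
    (J : H.Subgraph) : HasCloseCopy ω J.coe δ := by
  obtain ⟨I, l, φ, h1, -, h3⟩ := h
  have hmem : ∀ e : J.coe.edgeSet,
      Sym2.map (fun w : J.verts => (φ w : V)) (e : Sym2 J.verts) ∈ I.edgeSet := by
    rintro ⟨e, he⟩
    induction e using Sym2.ind with
    | _ a b =>
      have hab : H.Adj a b := J.adj_sub (by simpa using he)
      simpa using φ.map_adj_iff.2 hab
  refine ⟨⟨fun w => φ w, fun a b hab => Subtype.ext (φ.injective (Subtype.ext hab))⟩,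
    fun e => l (Sym2.map (fun w : J.verts => (φ w : V)) e), fun e => h1 _ (hmem e),
    fun e f => h3 _ (hmem e) _ (hmem f)⟩

/-- First moment bound for the existence of a copy of `H` with close labels. -/
theorem labelMeasure_hasCloseCopy_le {V W : Type*} [Fintype V] [DecidableEq V] [Fintype W]
    (H : SimpleGraph W) [Nonempty H.edgeSet] (ψ : PMF ℕ) {K : ℕ} (hK : 0 < K) {δ : ℝ}
    (hδ : δ ≤ 1 / K) :
    labelMeasure V ψ {ω | HasCloseCopy ω H δ} ≤
      (Fintype.card V : ENNReal) ^ Fintype.card W * ((K + 1 : ℕ) *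
        ((∑' k : ℕ, ψ k * (k : ENNReal)) * ENNReal.ofReal (2 / K)) ^ H.edgeSet.ncard) := by
  classical
  have hsub : {ω : LabelSpace V | HasCloseCopy ω H δ} ⊆ ⋃ φ : W ↪ V, ⋃ k : Fin (K + 1),
      {ω | ∀ e : H.edgeSet, ω (edgeImage φ e) ∈
        {z : ℕ × (ℕ → ℝ) | ∃ i < z.1, z.2 i ∈ gridWindow K k}} := by
    rintro ω ⟨φ, l, hl, hd⟩
    obtain ⟨k, hk, hw⟩ := exists_forall_mem_gridWindow hK l fun e f => (hd e f).trans_le hδ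
    refine Set.mem_iUnion₂.2 ⟨φ, ⟨k, by omega⟩, fun e => ?_⟩
    obtain ⟨_, i, hi, hil⟩ := hl e
    exact ⟨i, hi, hil ▸ hw e⟩
  refine (measure_mono hsub).trans ((measure_iUnion_fintype_le _ _).trans ?_)
  have hk : ∀ (φ : W ↪ V) (k : Fin (K + 1)), labelMeasure V ψ {ω | ∀ e : H.edgeSet,
      ω (edgeImage φ e) ∈ {z : ℕ × (ℕ → ℝ) | ∃ i < z.1, z.2 i ∈ gridWindow K k}} ≤
        ((∑' k : ℕ, ψ k * (k : ENNReal)) * ENNReal.ofReal (2 / K)) ^ H.edgeSet.ncard := by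
    intro φ k
    rw [labelMeasure, measure_pi_setOf_forall_mem _ _ (edgeImage_injective φ),
      Finset.prod_const, Finset.card_univ, ← Nat.card_eq_fintype_card, Nat.card_coe_set_eq]
    gcongr
    refine (edgeLaw_exists_mem_le ψ (measurableSet_gridWindow K k)).trans ?_
    gcongr
    exact unifIoc_gridWindow_le hK k
  calc _ ≤ ∑ φ : W ↪ V, ((K + 1 : ℕ) *
        ((∑' k : ℕ, ψ k * (k : ENNReal)) * ENNReal.ofReal (2 / K)) ^ H.edgeSet.ncard) := by
        refine Finset.sum_le_sum fun φ _ => (measure_iUnion_fintype_le _ _).trans ?_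
        refine (Finset.sum_le_sum fun k _ => hk φ k).trans_eq ?_
        simp
    _ ≤ _ := by
        rw [Finset.sum_const, nsmul_eq_mul, Finset.card_univ, Fintype.card_embedding_eq]
        gcongr
        exact_mod_cast Nat.descFactorial_le_pow _ _

theorem sparsity_pos {W : Type*} [Finite W] (H : SimpleGraph W) (hH : 2 ≤ H.edgeSet.ncard) :
    0 < sparsity H := by
  obtain ⟨I, hI, h⟩ := (sparsity_isLeast H hH).1
  rw [h]
  have h2 : (2 : ℝ) ≤ I.edgeSet.ncard := by exact_mod_cast hI
  have h3 : 0 < I.verts.ncard := by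
    obtain ⟨e, he⟩ := Set.nonempty_of_ncard_ne_zero (s := I.edgeSet) (by omega)
    induction e using Sym2.ind with
    | _ a b => exact (Set.ncard_pos (Set.toFinite _)).2 ⟨a, I.edge_vert he⟩
  have h4 : (0 : ℝ) < I.verts.ncard := by exact_mod_cast h3
  exact div_pos h4 (by linarith)

theorem ncard_edgeSet_coe {W : Type*} {H : SimpleGraph W} (I : H.Subgraph) :
    I.coe.edgeSet.ncard = I.edgeSet.ncard := by
  rw [← SimpleGraph.Subgraph.image_coe_edgeSet_coe,
    Set.ncard_image_of_injective _ (Sym2.map.injective Subtype.val_injective)]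

/-- The first moment bound is applied to a subgraph `I` attaining the sparsity. Since `v = ρ * (e -
1)`, it becomes a constant times `(n ^ ρ * δ) ^ (e - 1)`, with `e - 1 ≥ 1`. -/
theorem tendsto_not_containsMotif {W : Type*} [Fintype W] (H : SimpleGraph W)
    (hH : 2 ≤ H.edgeSet.ncard) (P : H.edgeSet → H.edgeSet → Prop)
    (ψ : PMF ℕ) (hψ : ∑' k : ℕ, ψ k * (k : ENNReal) < ⊤) (δ : ℕ → ℝ)
    (hδ : δ =o[atTop] (fun n : ℕ => (n : ℝ) ^ (-sparsity H))) :
    Tendsto (fun n : ℕ => labelMeasure (Fin n) ψ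
      {ω | ¬ (sampledGraph ω).ContainsMotif H P (δ n)}) atTop (𝓝 1) := by
  classical
  obtain ⟨I, hI, hρ⟩ := (sparsity_isLeast H hH).1
  have hρ0 := sparsity_pos H hH
  set ρ := sparsity H with hρdef
  obtain ⟨r, hr⟩ : ∃ r, I.edgeSet.ncard = r + 2 := ⟨I.edgeSet.ncard - 2, by omega⟩
  set v := I.verts.ncard with hv
  set M := (∑' k : ℕ, ψ k * (k : ENNReal)).toReal with hM
  have hM' : ∑' k : ℕ, ψ k * (k : ENNReal) = ENNReal.ofReal M :=
    (ENNReal.ofReal_toReal hψ.ne).symm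
  have hM0 : 0 ≤ M := ENNReal.toReal_nonneg
  have hvρ : (v : ℝ) = ρ * (r + 1 : ℕ) := by
    rw [hρ, hr]
    push_cast
    rw [show (r : ℝ) + 2 - 1 = r + 1 by ring, div_mul_cancel₀ _ (by positivity)]
  have hratio : Tendsto (fun n => δ n / (n : ℝ) ^ (-ρ)) atTop (𝓝 0) := hδ.tendsto_div_nhds_zero
  -- The factors come from `K + 1 ≤ 2 * K`, from the probability `2 * M / K` per edge, and from `1 /
  -- K ≤ 2 * δ n` for the `r + 1` powers of `1 / K` left after summing over windows.
  set C := 2 * (2 * M) ^ (r + 2) * 2 ^ (r + 1) with hC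
  refine tendsto_measure_one_of_compl (fun n => labelMeasure (Fin n) ψ) _
    (fun n => C * |δ n / (n : ℝ) ^ (-ρ)| ^ (r + 1)) ?_ ?_
  · have := (hratio.abs.pow (r + 1)).const_mul C
    simpa using this
  have hδ1 : ∀ᶠ n in atTop, δ n ≤ 1 := by
    have h0 : Tendsto (fun n : ℕ => (n : ℝ) ^ (-ρ)) atTop (𝓝 0) :=
      (tendsto_rpow_neg_atTop hρ0).comp tendsto_natCast_atTop_atTop
    have : Tendsto δ atTop (𝓝 0) := hδ.trans_tendsto h0
    exact this.eventually_le_const one_pos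
  have hne : Nonempty I.coe.edgeSet := by
    obtain ⟨e, he⟩ := Set.nonempty_of_ncard_ne_zero (s := I.coe.edgeSet)
      (by rw [ncard_edgeSet_coe]; omega)
    exact ⟨⟨e, he⟩⟩
  filter_upwards [hδ1, eventually_gt_atTop 0] with n hn hn0
  have hsub : {ω : LabelSpace (Fin n) | ¬ (sampledGraph ω).ContainsMotif H P (δ n)}ᶜ ⊆
      {ω | HasCloseCopy ω I.coe (δ n)} := fun ω hω =>
    hasCloseCopy_of_containsMotif (not_not.1 hω) I
  refine (measure_mono hsub).trans ?_
  -- For `δ n ≤ 0` an edge compared with itself already violates the closeness condition.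
  rcases le_or_gt (δ n) 0 with hneg | hpos
  · have : {ω : LabelSpace (Fin n) | HasCloseCopy ω I.coe (δ n)} = ∅ := by
      refine Set.eq_empty_of_forall_notMem ?_
      rintro ω ⟨φ, l, -, hl⟩
      have := hl hne.some hne.some
      linarith
    simp [this]
  set K := ⌊1 / δ n⌋₊ with hKdef
  have h1δ : 1 ≤ 1 / δ n := by rwa [one_le_div hpos]
  have hK : 0 < K := Nat.floor_pos.2 h1δ
  have hK' : (1 : ℝ) ≤ K := by exact_mod_cast hK
  have hKδ : δ n ≤ 1 / K := by
    rw [le_one_div hpos (by linarith)]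
    exact Nat.floor_le (by positivity)
  have hKδ' : 1 / (K : ℝ) ≤ 2 * δ n := by
    have := Nat.lt_floor_add_one (1 / δ n)
    rw [div_lt_iff₀ hpos] at this
    rw [div_le_iff₀ (by linarith)]
    nlinarith
  refine (labelMeasure_hasCloseCopy_le I.coe ψ hK hKδ).trans ?_
  rw [ncard_edgeSet_coe, hr, Fintype.card_fin, hM', ← ENNReal.ofReal_mul hM0,
    ← Nat.card_eq_fintype_card, Nat.card_coe_set_eq, ← hv, ← ENNReal.ofReal_pow (by positivity),
    ← ENNReal.ofReal_natCast, ← ENNReal.ofReal_natCast, ← ENNReal.ofReal_pow (by positivity),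
    ← ENNReal.ofReal_mul (by positivity), ← ENNReal.ofReal_mul (by positivity)]
  refine ENNReal.ofReal_le_ofReal ?_
  have hnr : (0 : ℝ) < n := by exact_mod_cast hn0
  have hnv : (n : ℝ) ^ v = ((n : ℝ) ^ ρ) ^ (r + 1) := by
    rw [← Real.rpow_natCast, hvρ, Real.rpow_mul hnr.le, Real.rpow_natCast]
  rw [Real.rpow_neg hnr.le, div_inv_eq_mul, abs_of_pos (by positivity), mul_pow (δ n), hnv]
  have hstep : ((K + 1 : ℕ) : ℝ) * (M * (2 / K)) ^ (r + 2) ≤ C * δ n ^ (r + 1) := by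
    have h1 : ((K + 1 : ℕ) : ℝ) ≤ 2 * K := by push_cast; linarith
    calc ((K + 1 : ℕ) : ℝ) * (M * (2 / K)) ^ (r + 2)
        ≤ 2 * K * (M * (2 / K)) ^ (r + 2) := by gcongr
      _ = 2 * (2 * M) ^ (r + 2) * (1 / K) ^ (r + 1) := by
          have hK0 : (K : ℝ) ≠ 0 := by positivity
          rw [show M * (2 / (K : ℝ)) = 2 * M * (1 / K) by ring, mul_pow (2 * M),
            pow_succ (1 / (K : ℝ))]
          field_simp
      _ ≤ 2 * (2 * M) ^ (r + 2) * (2 * δ n) ^ (r + 1) := by gcongr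
      _ = C * δ n ^ (r + 1) := by rw [hC, mul_pow 2 (δ n)]; ring
  calc ((n : ℝ) ^ ρ) ^ (r + 1) * (((K + 1 : ℕ) : ℝ) * (M * (2 / K)) ^ (r + 2))
      ≤ ((n : ℝ) ^ ρ) ^ (r + 1) * (C * δ n ^ (r + 1)) := by gcongr
    _ = _ := by ring

/-! ### Time slots and placed copies -/

/-- The `i`-th of the `m` slots of equal length in the `k`-th of the `K` windows of equal length
that partition `(0, 1]`. -/
def timeSlot (K m k i : ℕ) : Set ℝ :=
  Set.Ioc (((k * m + i : ℕ) : ℝ) / ((K * m : ℕ) : ℝ))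
    (((k * m + i + 1 : ℕ) : ℝ) / ((K * m : ℕ) : ℝ))

theorem measurableSet_timeSlot (K m k i : ℕ) : MeasurableSet (timeSlot K m k i) :=
  measurableSet_Ioc

theorem timeSlot_subset_Ioc {K m k i : ℕ} (hK : 0 < K) (hi : i < m) :
    timeSlot K m k i ⊆ Set.Ioc ((k : ℝ) / K) (((k : ℝ) + 1) / K) := by
  have hK' : (0 : ℝ) < K := by exact_mod_cast hK
  have hm' : (0 : ℝ) < m := by exact_mod_cast (Nat.zero_le i).trans_lt hi
  have hi' : (i : ℝ) + 1 ≤ m := by exact_mod_cast hi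
  refine Set.Ioc_subset_Ioc ?_ ?_
  · rw [div_le_div_iff₀ hK' (by push_cast; positivity)]
    push_cast
    have : (0 : ℝ) ≤ i * K := by positivity
    nlinarith
  · rw [div_le_div_iff₀ (by push_cast; positivity) hK']
    push_cast
    have := mul_le_mul_of_nonneg_left hi' hK'.le
    nlinarith

theorem unifIoc_timeSlot {K m k i : ℕ} (hk : k < K) (hi : i < m) :
    unifIoc (timeSlot K m k i) = ENNReal.ofReal (1 / (K * m)) := by
  have hK : 0 < K := (Nat.zero_le k).trans_lt hk
  have hK' : (0 : ℝ) < K := by exact_mod_cast hK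
  have hk' : (k : ℝ) + 1 ≤ K := by exact_mod_cast hk
  have hsub : timeSlot K m k i ⊆ Set.Ioc 0 1 := (timeSlot_subset_Ioc hK hi).trans
    (Set.Ioc_subset_Ioc (by positivity) (by rwa [div_le_one hK']))
  rw [unifIoc, Measure.restrict_apply (measurableSet_timeSlot K m k i), Set.inter_eq_left.2 hsub,
    timeSlot, Real.volume_Ioc, ← sub_div]
  push_cast
  congr 2
  ring

/-- Half-open windows are disjoint. This makes placed copies with a common edge but different
windows mutually exclusive. -/
theorem eq_of_mem_timeSlot {K m k k' i i' : ℕ} (hK : 0 < K) (hi : i < m) (hi' : i' < m) {x : ℝ}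
    (h : x ∈ timeSlot K m k i) (h' : x ∈ timeSlot K m k' i') : k = k' := by
  have hK' : (0 : ℝ) < K := by exact_mod_cast hK
  have h1 := timeSlot_subset_Ioc hK hi h
  have h2 := timeSlot_subset_Ioc hK hi' h'
  have h3 := (div_lt_div_iff_of_pos_right hK').1 (h1.1.trans_le h2.2)
  have h4 := (div_lt_div_iff_of_pos_right hK').1 (h2.1.trans_le h1.2)
  norm_cast at h3 h4
  omega

theorem lt_of_mem_timeSlot {K m k i i' : ℕ} (hii' : i < i') {x y : ℝ}
    (hx : x ∈ timeSlot K m k i) (hy : y ∈ timeSlot K m k i') : x < y := by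
  refine hx.2.trans_lt (lt_of_le_of_lt ?_ hy.1)
  have : ((k * m + i + 1 : ℕ) : ℝ) ≤ ((k * m + i' : ℕ) : ℝ) := by
    exact_mod_cast (by omega : k * m + i + 1 ≤ k * m + i')
  gcongr

theorem sub_lt_of_mem_timeSlot {K m k i i' : ℕ} (hK : 0 < K) (hi : i < m) (hi' : i' < m)
    {x y : ℝ} (hx : x ∈ timeSlot K m k i) (hy : y ∈ timeSlot K m k i') : x - y < 1 / K := by
  have h1 := (timeSlot_subset_Ioc hK hi hx).2
  have h2 := (timeSlot_subset_Ioc hK hi' hy).1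
  rw [add_div] at h1
  linarith

/-- The outcomes at a single edge that has a label and whose first label lies in a given slot. -/
def firstLabelIn (K m k i : ℕ) : Set (ℕ × (ℕ → ℝ)) :=
  {z | 0 < z.1 ∧ z.2 0 ∈ timeSlot K m k i}

theorem measurableSet_firstLabelIn (K m k i : ℕ) : MeasurableSet (firstLabelIn K m k i) := by
  have h1 : MeasurableSet (Prod.fst ⁻¹' {l | 0 < l} : Set (ℕ × (ℕ → ℝ))) :=
    measurable_fst MeasurableSet.of_discrete
  have h2 : MeasurableSet ((fun z : ℕ × (ℕ → ℝ) => z.2 0) ⁻¹' timeSlot K m k i) :=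
    ((measurable_pi_apply 0).comp measurable_snd) (measurableSet_timeSlot K m k i)
  exact h1.inter h2

theorem edgeLaw_real_firstLabelIn (ψ : PMF ℕ) {K m k i : ℕ} (hk : k < K) (hi : i < m) :
    (edgeLaw ψ).real (firstLabelIn K m k i) = ψ.toMeasure.real {l | 0 < l} / (K * m) := by
  rw [measureReal_def, firstLabelIn, edgeLaw_setOf_lt_and_mem ψ 0 (measurableSet_timeSlot K m k i),
    unifIoc_timeSlot hk hi, ENNReal.toReal_mul, ENNReal.toReal_ofReal (by positivity),
    measureReal_def]
  ring

/-- The event that the copy of `H` given by `φ` has all its first labels in the `k`-th window, the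
label of the edge `e` being in the slot `σ e`. -/
def placedCopy {V W : Type*} {H : SimpleGraph W} (K m : ℕ) (σ : H.edgeSet → ℕ) (φ : W ↪ V)
    (k : ℕ) : Set (LabelSpace V) :=
  {ω | ∀ e, ω (edgeImage φ e) ∈ firstLabelIn K m k (σ e)}

theorem measurableSet_placedCopy {V W : Type*} {H : SimpleGraph W} [Finite W] (K m : ℕ)
    (σ : H.edgeSet → ℕ) (φ : W ↪ V) (k : ℕ) : MeasurableSet (placedCopy K m σ φ k) := by
  rw [placedCopy, Set.ofPred_forall]
  exact MeasurableSet.iInter fun e =>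
    (measurable_pi_apply (edgeImage φ e)) (measurableSet_firstLabelIn K m k (σ e))

/-- Slots follow the heights, which forces the order, and lie in one window of length `1 / K ≤ δ`,
which forces closeness. The first label of each edge serves as its chosen label. -/
theorem containsMotif_of_mem_placedCopy {V W : Type*} {H : SimpleGraph W}
    {P : H.edgeSet → H.edgeSet → Prop} {K m k : ℕ} (hK : 0 < K) {σ : H.edgeSet → ℕ}
    (hσm : ∀ e, σ e < m) (hσ : ∀ e f, P e f → σ e < σ f) {φ : W ↪ V} {δ : ℝ} (hδ : 1 / K ≤ δ)
    {ω : LabelSpace V} (hω : ω ∈ placedCopy K m σ φ k) :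
    (sampledGraph ω).ContainsMotif H P δ := by
  classical
  -- The default `0` is never used: an injective image of an edge is not diagonal.
  let l : Sym2 V → ℝ := fun e => if h : ¬ e.IsDiag then (ω ⟨e, h⟩).2 0 else 0
  have hl : ∀ e : H.edgeSet, l (Sym2.map φ e) = (ω (edgeImage φ e)).2 0 := fun e =>
    dif_pos (edgeImage φ e).2
  have hlab : ∀ e : H.edgeSet, l (Sym2.map φ e) ∈ sampledLabels ω (Sym2.map φ e) := fun e =>
    ⟨(edgeImage φ e).2, 0, (hω e).1, (hl e).symm⟩
  have hadj : ∀ {a b}, H.Adj a b → (sampledGraph ω).footprint.Adj (φ a) (φ b) := fun {a b} hab =>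
    (SimpleGraph.fromEdgeSet_adj _).2 ⟨⟨_, hlab ⟨s(a, b), hab⟩⟩, φ.injective.ne hab.ne⟩
  let c : H.Copy (sampledGraph ω).footprint := ⟨⟨φ, hadj⟩, φ.injective⟩
  have hmem : ∀ e ∈ c.toSubgraph.edgeSet, ∃ f : H.edgeSet, Sym2.map φ f = e := by
    intro e he
    induction e using Sym2.ind with
    | _ x y =>
      obtain ⟨a, b, hab, rfl, rfl⟩ := he
      exact ⟨⟨s(a, b), by simpa using hab⟩, rfl⟩
  refine ⟨c.toSubgraph, l, c.isoToSubgraph, ?_, ?_, ?_⟩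
  · intro e he
    obtain ⟨f, rfl⟩ := hmem e he
    exact hlab f
  · intro e f hef
    change l (Sym2.map φ e) < l (Sym2.map φ f)
    rw [hl, hl]
    exact lt_of_mem_timeSlot (hσ e f hef) (hω e).2 (hω f).2
  · intro e he f hf
    obtain ⟨e, rfl⟩ := hmem e he
    obtain ⟨f, rfl⟩ := hmem f hf
    rw [hl, hl]
    exact (sub_lt_of_mem_timeSlot hK (hσm e) (hσm f) (hω e).2 (hω f).2).trans_le hδ

/-- A strict order on a finite type has a strictly monotone height function with values less than
the cardinality. -/
theorem exists_height {α : Type*} [Fintype α] (P : α → α → Prop) [IsStrictOrder α P] :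
    ∃ σ : α → ℕ, (∀ a, σ a < Fintype.card α) ∧ ∀ a b, P a b → σ a < σ b := by
  classical
  refine ⟨fun a => (Finset.univ.filter fun c => P c a).card, fun a => ?_, fun a b hab => ?_⟩
  · refine Finset.card_lt_univ_of_notMem (x := a) ?_
    simpa using irrefl_of P a
  · refine Finset.card_lt_card (Finset.ssubset_iff_of_subset ?_ |>.2 ⟨a, ?_, ?_⟩)
    · intro c hc
      simp only [Finset.mem_filter_univ] at hc ⊢
      exact trans_of P hc hab
    · simpa using hab
    · simpa using irrefl_of P a

/-! ### Overlaps and covariances -/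

/-- The joint probability of two families of constraints, each of probability `s`, on coordinates
that may overlap. -/
theorem measureReal_pi_inter_le {ι κ Ω : Type*} [Fintype ι] [Fintype κ] [MeasurableSpace Ω]
    (ν : Measure Ω) [IsProbabilityMeasure ν] {g g' : κ → ι} (hg : Function.Injective g)
    (hg' : Function.Injective g') {S S' : κ → Set Ω} {s : ℝ} (hS : ∀ a, ν.real (S a) = s)
    (hS' : ∀ a, ν.real (S' a) = s) [DecidablePred fun a => g' a ∈ Set.range g] :
    (Measure.pi fun _ : ι => ν).real
        ({ω | ∀ a, ω (g a) ∈ S a} ∩ {ω | ∀ a, ω (g' a) ∈ S' a}) ≤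
      s ^ (Fintype.card κ + (Fintype.card κ -
        (Finset.univ.filter fun a => g' a ∈ Set.range g).card)) := by
  classical
  -- On shared coordinates only the constraint from `S` is kept, so all remaining constraints sit on
  -- distinct coordinates.
  let h : κ ⊕ {a // ¬ g' a ∈ Set.range g} → ι := Sum.elim g fun a => g' a
  let T : κ ⊕ {a // ¬ g' a ∈ Set.range g} → Set Ω := Sum.elim S fun a => S' a
  have hh : Function.Injective h := by
    refine hg.sumElim (hg'.comp Subtype.val_injective) fun a b hab => b.2 ⟨a, hab⟩
  have hT : ∀ a, ν.real (T a) = s := by rintro (a | a) <;> simp [T, hS, hS']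
  have hsub : ({ω | ∀ a, ω (g a) ∈ S a} ∩ {ω | ∀ a, ω (g' a) ∈ S' a} : Set (ι → Ω)) ⊆
      {ω | ∀ a, ω (h a) ∈ T a} := by
    rintro ω ⟨h1, h2⟩ (a | a)
    · exact h1 a
    · exact h2 a
  refine (measureReal_mono hsub).trans_eq ?_
  rw [measureReal_def, measure_pi_setOf_forall_mem _ _ hh, ENNReal.toReal_prod,
    Finset.prod_congr rfl fun a _ => (measureReal_def ν (T a)).symm.trans (hT a),
    Finset.prod_const, Finset.card_univ, Fintype.card_sum,
    Fintype.card_subtype_compl, Fintype.card_subtype]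

/-- Relaxing embeddings to arbitrary maps makes the sum factor over `W`: each vertex contributes `x`
for a value in `R` and `1` for any other. -/
theorem sum_embedding_pow_card_le {V W : Type*} [Fintype V] [DecidableEq V] [Fintype W]
    (R : Finset V) {x : ℝ} (hx : 0 ≤ x) :
    ∑ φ : W ↪ V, x ^ (Finset.univ.filter fun w => φ w ∈ R).card ≤
      (R.card * x + Fintype.card V) ^ Fintype.card W := by
  classical
  let F : (W → V) → ℝ := fun f => ∏ w, if f w ∈ R then x else 1
  have hF : ∀ φ : W ↪ V, x ^ (Finset.univ.filter fun w => φ w ∈ R).card = F φ := fun φ => by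
    simp [F, Finset.prod_ite]
  have hF0 : ∀ f, 0 ≤ F f := fun f => Finset.prod_nonneg fun w _ => by split_ifs <;> positivity
  calc ∑ φ : W ↪ V, x ^ (Finset.univ.filter fun w => φ w ∈ R).card
      = ∑ f ∈ Finset.univ.map ⟨fun φ : W ↪ V => (φ : W → V), DFunLike.coe_injective⟩, F f := by
        simp [hF]
    _ ≤ ∑ f, F f := Finset.sum_le_sum_of_subset_of_nonneg (Finset.subset_univ _) fun f _ _ => hF0 f
    _ = ∏ _w : W, ∑ y : V, if y ∈ R then x else 1 := by
        rw [Finset.prod_univ_sum, Fintype.piFinset_univ]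
    _ ≤ _ := by
        rw [Finset.prod_const, Finset.card_univ]
        refine pow_le_pow_left₀ (Finset.sum_nonneg fun y _ => by split_ifs <;> positivity) ?_ _
        calc ∑ y : V, (if y ∈ R then x else 1)
            ≤ ∑ y : V, ((if y ∈ R then x else 0) + 1) :=
              Finset.sum_le_sum fun y _ => by split_ifs <;> linarith
          _ = _ := by simp [Finset.sum_add_distrib]

theorem sparsity_mul_le {W : Type*} [Finite W] {H : SimpleGraph W} (J : H.Subgraph)
    (hJ : 2 ≤ J.edgeSet.ncard) :
    sparsity H * (J.edgeSet.ncard - 1 : ℕ) ≤ J.verts.ncard := by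
  have hH : 2 ≤ H.edgeSet.ncard :=
    hJ.trans (Set.ncard_le_ncard J.edgeSet_subset (Set.toFinite _))
  have h := (sparsity_isLeast H hH).2 ⟨J, hJ, rfl⟩
  have h2 : (2 : ℝ) ≤ J.edgeSet.ncard := by exact_mod_cast hJ
  rw [le_div_iff₀ (by linarith)] at h
  rwa [Nat.cast_sub (by omega), Nat.cast_one]

/-- Here the sparsity enters the second moment. With two or more edges, `n ^ (ρ * (e - 1)) ≤ n ^ v`,
and one factor `K / n ^ ρ` is retained as the gain. The sparsity says nothing about a single edge;
there the term `1 / n` and `v ≥ 1` suffice. -/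
theorem pow_ncard_edgeSet_le {W : Type*} [Finite W] {H : SimpleGraph W} (J : H.Subgraph)
    (hJ : 1 ≤ J.edgeSet.ncard) {n K : ℕ} (hn : 0 < n)
    (hKn : (K : ℝ) / (n : ℝ) ^ sparsity H ≤ 1) :
    (K : ℝ) ^ (J.edgeSet.ncard - 1) ≤
      (1 / n + (K : ℝ) / (n : ℝ) ^ sparsity H) * (n : ℝ) ^ J.verts.ncard := by
  have hn' : (1 : ℝ) ≤ n := by exact_mod_cast hn
  have hnρ : (0 : ℝ) < (n : ℝ) ^ sparsity H := by positivity
  have hq : 0 ≤ (K : ℝ) / (n : ℝ) ^ sparsity H := by positivity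
  rcases hJ.eq_or_lt with h1 | h2
  · have hv : J.verts.ncard ≠ 0 := by
      obtain ⟨e, he⟩ := Set.nonempty_of_ncard_ne_zero (s := J.edgeSet) (by omega)
      induction e using Sym2.ind with
      | _ a b => exact ((Set.ncard_pos (Set.toFinite _)).2 ⟨a, J.edge_vert he⟩).ne'
    rw [← h1, Nat.sub_self, pow_zero]
    calc (1 : ℝ) = 1 / n * n := by field_simp
      _ ≤ (1 / n + (K : ℝ) / (n : ℝ) ^ sparsity H) * (n : ℝ) ^ J.verts.ncard := by
        gcongr
        · linarith
        · exact le_self_pow₀ hn' hv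
  · obtain ⟨r, hr⟩ : ∃ r, J.edgeSet.ncard - 1 = r + 1 := ⟨J.edgeSet.ncard - 2, by omega⟩
    have h3 := sparsity_mul_le J h2
    rw [hr] at h3 ⊢
    have h4 : ((n : ℝ) ^ sparsity H) ^ (r + 1) ≤ (n : ℝ) ^ J.verts.ncard := by
      rw [← Real.rpow_natCast, ← Real.rpow_mul (by positivity), ← Real.rpow_natCast _ J.verts.ncard]
      exact Real.rpow_le_rpow_of_exponent_le hn' h3
    calc (K : ℝ) ^ (r + 1)
        = ((K : ℝ) / (n : ℝ) ^ sparsity H) ^ (r + 1) * ((n : ℝ) ^ sparsity H) ^ (r + 1) := by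
          rw [← mul_pow, div_mul_cancel₀ _ hnρ.ne']
      _ ≤ (1 / n + (K : ℝ) / (n : ℝ) ^ sparsity H) * (n : ℝ) ^ J.verts.ncard := by
          gcongr
          refine (pow_le_of_le_one hq hKn (by omega)).trans ?_
          have : (0 : ℝ) ≤ 1 / n := by positivity
          linarith

/-- The part of `H` that the copy `φ'` shares with the copy `φ`. -/
def overlapSubgraph {V W : Type*} {H : SimpleGraph W} (φ φ' : W ↪ V) : H.Subgraph where
  verts := {w | φ' w ∈ Set.range φ}
  Adj a b := H.Adj a b ∧ ∃ f ∈ H.edgeSet, Sym2.map φ f = s(φ' a, φ' b)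
  adj_sub h := h.1
  edge_vert := by
    rintro a b ⟨-, f, -, hf⟩
    have : φ' a ∈ Sym2.map φ f := hf ▸ Sym2.mem_mk_left _ _
    obtain ⟨c, -, hc⟩ := Sym2.mem_map.1 this
    exact ⟨c, hc⟩
  symm := ⟨fun a b h => ⟨h.1.symm, by rw [Sym2.eq_swap]; exact h.2⟩⟩

theorem ncard_edgeSet_overlapSubgraph {V W : Type*} {H : SimpleGraph W} [Fintype H.edgeSet]
    (φ φ' : W ↪ V)
    [DecidablePred fun e : H.edgeSet => edgeImage φ' e ∈ Set.range (edgeImage (H := H) φ)] :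
    (overlapSubgraph (H := H) φ φ').edgeSet.ncard =
      (Finset.univ.filter fun e : H.edgeSet =>
        edgeImage φ' e ∈ Set.range (edgeImage (H := H) φ)).card := by
  rw [← Set.ncard_coe_finset, ← Set.ncard_image_of_injective _ Subtype.val_injective]
  congr 1
  ext e
  induction e using Sym2.ind with
  | _ a b =>
    simp only [Finset.coe_filter, Finset.mem_univ, true_and, Set.mem_image, Subtype.exists,
      SimpleGraph.Subgraph.mem_edgeSet]
    constructor
    · rintro ⟨h1, f, hf, h2⟩
      exact ⟨s(a, b), h1, ⟨⟨f, hf⟩, Subtype.ext h2⟩, rfl⟩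
    · rintro ⟨e, he, ⟨f, hf⟩, rfl⟩
      exact ⟨he, f, f.2, congrArg Subtype.val hf⟩

section PlacedCopies

variable {V W : Type*} [Fintype V] [DecidableEq V] {H : SimpleGraph W} [Fintype H.edgeSet]
  (ψ : PMF ℕ) {K : ℕ} {σ : H.edgeSet → ℕ}

theorem labelMeasure_real_placedCopy (hσ : ∀ e, σ e < Fintype.card H.edgeSet) (φ : W ↪ V)
    {k : ℕ} (hk : k < K) :
    (labelMeasure V ψ).real (placedCopy K (Fintype.card H.edgeSet) σ φ k) =
      (ψ.toMeasure.real {l | 0 < l} / (K * Fintype.card H.edgeSet)) ^ Fintype.card H.edgeSet := by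
  rw [measureReal_def, labelMeasure, placedCopy,
    measure_pi_setOf_forall_mem _ _ (edgeImage_injective φ), ENNReal.toReal_prod,
    Finset.prod_congr rfl fun e _ => (measureReal_def _ _).symm.trans
      (edgeLaw_real_firstLabelIn ψ hk (hσ e)), Finset.prod_const, Finset.card_univ]

open Classical in
/-- Covariance bound for two placed copies. -/
theorem covariance_placedCopy_le (hσ : ∀ e, σ e < Fintype.card H.edgeSet) (φ φ' : W ↪ V)
    {k k' : ℕ} (hk : k < K) (hk' : k' < K) {s : ℝ}
    (hs : s = ψ.toMeasure.real {l | 0 < l} / (K * Fintype.card H.edgeSet)) :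
    (labelMeasure V ψ).real (placedCopy K (Fintype.card H.edgeSet) σ φ k ∩
        placedCopy K (Fintype.card H.edgeSet) σ φ' k') -
      s ^ Fintype.card H.edgeSet * s ^ Fintype.card H.edgeSet ≤
    if k = k' ∧ 1 ≤ (overlapSubgraph (H := H) φ φ').edgeSet.ncard then
      s ^ (Fintype.card H.edgeSet +
        (Fintype.card H.edgeSet - (overlapSubgraph (H := H) φ φ').edgeSet.ncard)) else 0 := by
  have hs0 : 0 ≤ s := by rw [hs]; positivity
  have hle := measureReal_pi_inter_le (edgeLaw ψ) (edgeImage_injective (H := H) φ)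
    (edgeImage_injective (H := H) φ')
    (S := fun e => firstLabelIn K (Fintype.card H.edgeSet) k (σ e))
    (S' := fun e => firstLabelIn K (Fintype.card H.edgeSet) k' (σ e))
    (fun e => (edgeLaw_real_firstLabelIn ψ hk (hσ e)).trans hs.symm)
    (fun e => (edgeLaw_real_firstLabelIn ψ hk' (hσ e)).trans hs.symm)
  rw [← ncard_edgeSet_overlapSubgraph φ φ'] at hle
  split_ifs with h
  · refine le_trans (sub_le_self _ (by positivity)) hle
  rw [sub_nonpos]
  -- A common edge now means different windows, hence an empty intersection; without one, the joint
  -- bound is exactly the product.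
  by_cases hj : 1 ≤ (overlapSubgraph (H := H) φ φ').edgeSet.ncard
  · have hkk : k ≠ k' := fun hkk => h ⟨hkk, hj⟩
    have hempty : placedCopy K (Fintype.card H.edgeSet) σ φ k ∩
        placedCopy K (Fintype.card H.edgeSet) σ φ' k' = ∅ := by
      rw [ncard_edgeSet_overlapSubgraph φ φ', Nat.one_le_iff_ne_zero, Finset.card_ne_zero] at hj
      obtain ⟨e, he⟩ := hj
      obtain ⟨f, hf⟩ := (Finset.mem_filter.1 he).2
      refine Set.eq_empty_of_forall_notMem fun ω hω => hkk ?_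
      have h1 := (hω.1 f).2
      rw [hf] at h1
      exact eq_of_mem_timeSlot (by omega) (hσ f) (hσ e) h1 (hω.2 e).2
    rw [hempty, measureReal_empty]
    positivity
  · have hj0 : (overlapSubgraph (H := H) φ φ').edgeSet.ncard = 0 := by omega
    rw [hj0, Nat.sub_zero, pow_add] at hle
    exact hle

end PlacedCopies

/-! ### Second moment: a motif above the threshold -/

/-- Second moment bound for the probability that no copy of `H` is placed in any window. -/
theorem labelMeasure_real_no_placedCopy_le {W : Type*} [Fintype W] {H : SimpleGraph W}
    [Fintype H.edgeSet] [Nonempty H.edgeSet] (ψ : PMF ℕ)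
    (hp : 0 < ψ.toMeasure.real {l | 0 < l}) {K n : ℕ} (hK : 0 < K) (hn : 0 < n)
    (hnW : 2 * Fintype.card W ≤ n) (hKn : (K : ℝ) / (n : ℝ) ^ sparsity H ≤ 1)
    {σ : H.edgeSet → ℕ} (hσ : ∀ e, σ e < Fintype.card H.edgeSet) :
    (labelMeasure (Fin n) ψ).real
        (⋂ x : (W ↪ Fin n) × Fin K, (placedCopy K (Fintype.card H.edgeSet) σ x.1 x.2)ᶜ) ≤
      (Fintype.card H.edgeSet / ψ.toMeasure.real {l | 0 < l}) ^ Fintype.card H.edgeSet *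
        (2 * (Fintype.card W + 1)) ^ Fintype.card W *
        (1 / n + (K : ℝ) / (n : ℝ) ^ sparsity H) := by
  classical
  set m := Fintype.card H.edgeSet with hm
  set v := Fintype.card W with hv
  set p := ψ.toMeasure.real {l | 0 < l} with hpdef
  set θ := 1 / (n : ℝ) + (K : ℝ) / (n : ℝ) ^ sparsity H with hθ
  -- Chosen so that `s⁻¹ = K * b`. As `b ≥ 1`, its powers are all bounded by `b ^ m`, uniformly in
  -- the overlap.
  set b : ℝ := m / p with hb
  set s : ℝ := p / (K * m) with hs
  set μ := labelMeasure (Fin n) ψ with hμ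
  set N := Fintype.card (W ↪ Fin n) with hN
  have hmpos : 0 < m := Fintype.card_pos
  have hm' : (1 : ℝ) ≤ m := by exact_mod_cast hmpos
  have hK' : (0 : ℝ) < K := by exact_mod_cast hK
  have hn' : (0 : ℝ) < n := by exact_mod_cast hn
  have hp1 : p ≤ 1 := measureReal_le_one
  have hb1 : 1 ≤ b := by rw [hb, one_le_div hp]; linarith
  have hspos : 0 < s := by positivity
  have hsb : s * (K * b) = 1 := by rw [hs, hb]; field_simp
  have hθ0 : 0 ≤ θ := by positivity
  set B : ℝ := s ^ m * s ^ m * (K * b ^ m * θ) with hB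
  have hpair : ∀ x y : (W ↪ Fin n) × Fin K,
      μ.real (placedCopy K m σ x.1 x.2 ∩ placedCopy K m σ y.1 y.2) - s ^ m * s ^ m ≤
        if x.2 = y.2 then
          B * (n : ℝ) ^ (Finset.univ.filter fun w => y.1 w ∈ Finset.univ.map x.1).card else 0 := by
    rintro ⟨φ, k⟩ ⟨φ', k'⟩
    refine (covariance_placedCopy_le ψ hσ φ φ' k.2 k'.2 hs).trans ?_
    simp only [← hm]
    by_cases hkk : k = k'
    swap
    · simp [hkk, Fin.val_inj]
    subst hkk
    simp only [true_and, if_true]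
    split_ifs with hj
    swap
    · positivity
    have hverts : (overlapSubgraph (H := H) φ φ').verts.ncard =
        (Finset.univ.filter fun w => φ' w ∈ Finset.univ.map φ).card := by
      rw [← Set.ncard_coe_finset]
      congr 1
      ext w
      simp [overlapSubgraph]
    rw [← hverts]
    have hjm : (overlapSubgraph (H := H) φ φ').edgeSet.ncard ≤ m := by
      rw [ncard_edgeSet_overlapSubgraph]
      exact Finset.card_le_univ _
    have hθle := pow_ncard_edgeSet_le (overlapSubgraph (H := H) φ φ') hj hn hKn
    rw [← hθ] at hθle
    obtain ⟨j, hjj⟩ : ∃ j, (overlapSubgraph (H := H) φ φ').edgeSet.ncard = j + 1 :=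
      ⟨_, (Nat.sub_add_cancel hj).symm⟩
    rw [hjj] at hjm hθle ⊢
    rw [Nat.add_sub_cancel] at hθle
    -- Each of the `j + 1` shared edges saves a factor `s`, costing `K * b` relative to
    -- independence. One `K` is set aside; it is absorbed because the two windows coincide.
    have hexp : s ^ (m + (m - (j + 1))) = s ^ m * s ^ m * (K * b ^ (j + 1) * K ^ j) := by
      have h1 : s ^ m = s ^ (m - (j + 1)) * s ^ (j + 1) := by
        rw [← pow_add, Nat.sub_add_cancel hjm]
      have h2 : s ^ (j + 1) * (K * b ^ (j + 1) * K ^ j) = 1 := by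
        rw [show (K : ℝ) * b ^ (j + 1) * K ^ j = (K * b) ^ (j + 1) by rw [mul_pow]; ring,
          ← mul_pow, hsb, one_pow]
      calc s ^ (m + (m - (j + 1))) = s ^ m * s ^ (m - (j + 1)) *
            (s ^ (j + 1) * (K * b ^ (j + 1) * K ^ j)) := by rw [h2, mul_one, pow_add]
        _ = s ^ m * (s ^ (m - (j + 1)) * s ^ (j + 1)) * (K * b ^ (j + 1) * K ^ j) := by ring
        _ = _ := by rw [← h1]
    rw [hexp, hB, mul_assoc (s ^ m * s ^ m), mul_assoc (K * b ^ m)]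
    have hbm : b ^ (j + 1) ≤ b ^ m := pow_le_pow_right₀ hb1 hjm
    gcongr
  have hsecond := sq_sum_mul_measureReal_iInter_compl_le μ
    (fun x : (W ↪ Fin n) × Fin K => placedCopy K m σ x.1 x.2)
    (fun x => measurableSet_placedCopy K m σ x.1 x.2)
  have hprob : ∀ x : (W ↪ Fin n) × Fin K, μ.real (placedCopy K m σ x.1 x.2) = s ^ m := fun x =>
    labelMeasure_real_placedCopy ψ hσ x.1 x.2.2
  simp only [hprob] at hsecond
  have hrow : ∀ x : (W ↪ Fin n) × Fin K, ∑ y : (W ↪ Fin n) × Fin K,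
      (μ.real (placedCopy K m σ x.1 x.2 ∩ placedCopy K m σ y.1 y.2) - s ^ m * s ^ m) ≤
        B * ((v + 1) * n) ^ v := by
    intro x
    refine (Finset.sum_le_sum fun y _ => hpair x y).trans ?_
    rw [Fintype.sum_prod_type]
    simp only [Finset.sum_ite_eq, Finset.mem_univ, if_true]
    rw [← Finset.mul_sum]
    -- With weight `n` on each shared vertex, the `v` values in the range of `x.1` contribute `v *
    -- n` and all values together another `n`, giving `(v + 1) * n` per vertex.
    have := sum_embedding_pow_card_le (W := W) (Finset.univ.map x.1) hn'.le
    rw [Finset.card_map, Finset.card_univ, Fintype.card_fin, ← hv] at this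
    have hB0 : 0 ≤ B := by positivity
    refine mul_le_mul_of_nonneg_left (this.trans_eq ?_) hB0
    ring
  have hsum := hsecond.trans (Finset.sum_le_sum fun x _ => hrow x)
  simp only [Finset.sum_const, Finset.card_univ, Fintype.card_prod, Fintype.card_fin,
    nsmul_eq_mul, ← hN] at hsum
  push_cast at hsum
  have hNlow : ((n : ℝ) / 2) ^ v ≤ N := by
    rw [hN, Fintype.card_embedding_eq, Fintype.card_fin, ← hv]
    have h1 : ((n + 1 - v : ℕ) : ℝ) ^ v ≤ (n.descFactorial v : ℝ) := by
      exact_mod_cast Nat.pow_sub_le_descFactorial n v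
    refine le_trans ?_ h1
    gcongr
    rw [Nat.cast_sub (by omega)]
    have : (2 : ℝ) * v ≤ n := by exact_mod_cast hnW
    push_cast
    linarith
  have hN0 : (0 : ℝ) < N := lt_of_lt_of_le (by positivity) hNlow
  set q := μ.real (⋂ x : (W ↪ Fin n) × Fin K, (placedCopy K m σ x.1 x.2)ᶜ) with hq
  have hq0 : 0 ≤ q := measureReal_nonneg
  have hmain : N * q ≤ b ^ m * θ * ((v + 1) * n) ^ v := by
    have hc : 0 < (N : ℝ) * K ^ 2 * (s ^ m) ^ 2 := by positivity
    refine le_of_mul_le_mul_left ?_ hc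
    calc (N : ℝ) * K ^ 2 * (s ^ m) ^ 2 * (N * q) = (N * K * s ^ m) ^ 2 * q := by ring
      _ ≤ N * K * (B * ((v + 1) * n) ^ v) := hsum
      _ = _ := by rw [hB]; ring
  have hpos : 0 < ((n : ℝ) / 2) ^ v := by positivity
  refine le_of_mul_le_mul_left ?_ hpos
  calc ((n : ℝ) / 2) ^ v * q ≤ N * q := by gcongr
    _ ≤ b ^ m * θ * ((v + 1) * n) ^ v := hmain
    _ = b ^ m * θ * (n / 2 * (2 * (v + 1))) ^ v := by congr 2; ring
    _ = ((n : ℝ) / 2) ^ v * (b ^ m * (2 * (v + 1)) ^ v * θ) := by rw [mul_pow]; ring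

theorem tendsto_containsMotif {W : Type*} [Fintype W] (H : SimpleGraph W)
    (hH : 2 ≤ H.edgeSet.ncard) (P : H.edgeSet → H.edgeSet → Prop) [IsStrictOrder H.edgeSet P]
    (ψ : PMF ℕ) (hψ : 0 < ∑' k : ℕ, ψ k * (k : ENNReal)) (δ : ℕ → ℝ)
    (hδ : Tendsto (fun n : ℕ => δ n / (n : ℝ) ^ (-sparsity H)) atTop atTop) :
    Tendsto (fun n : ℕ => labelMeasure (Fin n) ψ
      {ω | (sampledGraph ω).ContainsMotif H P (δ n)}) atTop (𝓝 1) := by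
  classical
  have hp : 0 < ψ.toMeasure.real {l | 0 < l} :=
    ENNReal.toReal_pos (toMeasure_pos_of_first_pos ψ hψ).ne' (measure_ne_top _ _)
  have hρ0 := sparsity_pos H hH
  set ρ := sparsity H with hρ
  obtain ⟨e₀, he₀⟩ := Set.nonempty_of_ncard_ne_zero (s := H.edgeSet) (by omega)
  have hne : Nonempty H.edgeSet := ⟨⟨e₀, he₀⟩⟩
  obtain ⟨σ, hσm, hσ⟩ := exists_height P
  set C := (Fintype.card H.edgeSet / ψ.toMeasure.real {l | 0 < l}) ^ Fintype.card H.edgeSet *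
    (2 * ((Fintype.card W : ℝ) + 1)) ^ Fintype.card W with hC
  have hC0 : 0 ≤ C := by positivity
  -- Dominates `K / n ^ ρ`: the first term comes from `1 / δ n`, the second from rounding `K` up.
  set t : ℕ → ℝ := fun n => 2 * (δ n / (n : ℝ) ^ (-ρ))⁻¹ + 2 * (n : ℝ) ^ (-ρ) with ht
  have ht0 : Tendsto t atTop (𝓝 0) := by
    have h1 := (tendsto_inv_atTop_zero.comp hδ).const_mul 2
    have h2 := ((tendsto_rpow_neg_atTop hρ0).comp
      (tendsto_natCast_atTop_atTop (R := ℝ))).const_mul 2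
    simpa [ht] using h1.add h2
  refine tendsto_measure_one_of_compl (fun n => labelMeasure (Fin n) ψ) _
    (fun n => C * (1 / n + t n)) ?_ ?_
  · simpa using (tendsto_one_div_atTop_nhds_zero_nat.add ht0).const_mul C
  filter_upwards [hδ.eventually_gt_atTop 0, ht0.eventually_le_const one_pos,
    eventually_gt_atTop 0, eventually_ge_atTop (2 * Fintype.card W)] with n hn1 hn2 hn0 hnW
  have hnr : (0 : ℝ) < n := by exact_mod_cast hn0
  have hnρ : (0 : ℝ) < (n : ℝ) ^ ρ := by positivity
  have hnρ' : (0 : ℝ) < (n : ℝ) ^ (-ρ) := by positivity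
  have hδ0 : 0 < δ n := (div_pos_iff_of_pos_right hnρ').1 hn1
  set K := ⌈1 / δ n⌉₊ + 1 with hKdef
  have hK : 0 < K := Nat.succ_pos _
  have hK' : (0 : ℝ) < K := by exact_mod_cast hK
  have hKδ : 1 / (K : ℝ) ≤ δ n := by
    rw [one_div_le hK' hδ0, hKdef]
    push_cast
    exact (Nat.le_ceil _).trans (by linarith)
  have hKle : (K : ℝ) ≤ 1 / δ n + 2 := by
    have := Nat.ceil_lt_add_one (show 0 ≤ 1 / δ n by positivity)
    rw [hKdef]
    push_cast
    linarith
  have hKt : (K : ℝ) / (n : ℝ) ^ ρ ≤ t n := by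
    have h1 : t n = (2 * (1 / δ n) + 2) / (n : ℝ) ^ ρ := by
      simp only [ht]
      rw [Real.rpow_neg hnr.le]
      field_simp
    rw [h1]
    have : 0 < 1 / δ n := by positivity
    gcongr
    linarith
  have hsub : {ω : LabelSpace (Fin n) | (sampledGraph ω).ContainsMotif H P (δ n)}ᶜ ⊆
      ⋂ x : (W ↪ Fin n) × Fin K, (placedCopy K (Fintype.card H.edgeSet) σ x.1 x.2)ᶜ := by
    intro ω hω
    exact Set.mem_iInter.2 fun x hx => hω (containsMotif_of_mem_placedCopy hK hσm hσ hKδ hx)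
  refine (measure_mono hsub).trans ?_
  rw [← ofReal_measureReal]
  refine ENNReal.ofReal_le_ofReal ?_
  refine (labelMeasure_real_no_placedCopy_le ψ hp hK hn0 hnW (hKt.trans hn2) hσm).trans ?_
  rw [← hC]
  gcongr

theorem mainTheorem1 {W : Type*} [Fintype W] (H : SimpleGraph W)
    (hH : 2 ≤ H.edgeSet.ncard)
    (P : H.edgeSet → H.edgeSet → Prop) [IsStrictOrder H.edgeSet P]
    (ψ : PMF ℕ) (hψ : IsLabelMultiplicity ψ) (δ : ℕ → ℝ) :
    (Tendsto (fun n : ℕ => δ n / (n : ℝ) ^ (-sparsity H)) atTop atTop →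
      Tendsto (fun n : ℕ => labelMeasure (Fin n) ψ
        {ω | (sampledGraph ω).ContainsMotif H P (δ n)}) atTop (𝓝 1)) ∧
    (δ =o[atTop] (fun n : ℕ => (n : ℝ) ^ (-sparsity H)) →
      Tendsto (fun n : ℕ => labelMeasure (Fin n) ψ
        {ω | ¬ (sampledGraph ω).ContainsMotif H P (δ n)}) atTop (𝓝 1)) :=
  ⟨tendsto_containsMotif H hH P ψ hψ.first_pos δ,
    tendsto_not_containsMotif H hH P ψ hψ.first_lt_top δ⟩
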